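/- Let $k$ be a field with $\operatorname{char}(k)\neq 2$ and let $A=k\langle X,Y\rangle/(X^2,\;XY+YX,\;Y^2)$, with $x,y$ the residue classes of $X,Y$. Let $A^e=A\otimes_k A^{\mathrm{op}}$, acting on $A$ on the left by $(a\otimes b)\cdot m=amb$, and let $HH^*(A)=\bigoplus_{n\ge 0}HH^n(A)$, $HH^n(A)=\operatorname{Ext}^n_{A^e}(A,A)$, be the Hochschild cohomology ring with the Yoneda product. For $z\in A$ put $\alpha_z=1\otimes z-z\otimes 1$ and $\beta_z=1\otimes z+z\otimes 1$ in $A^e$. For $n\ge 0$ let $P_n$ be the free left $A^e$-module with basis $f^n_0,\dots,f^n_n$, put $f^n_{-1}=f^n_{n+1}=0$, and for $n\ge 1$ let $d_n:P_n\to P_{n-1}$ be the $A^e$-linear map with $$d_n(f^n_i)=\begin{cases}(-1)^i(\beta_y f^{n-1}_i+\beta_x f^{n-1}_{i-1}) & n \text{ even},\\ (-1)^i(\alpha_y f^{n-1}_i-\alpha_x f^{n-1}_{i-1}) & n\text{ odd}.\end{cases}$$ Then $\cdots\to P_1\to P_0\to A\to 0$, with $P_0\to A$, $f^0_0\mapsto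 1$, is a projective resolution of the $A^e$-module $A$. Moreover, let $n=2t$ with $t\ge 0$, and for $r=0,\dots,2t$ let $\xi_r,\eta_r:P_{2t}\to A$ be the $A^e$-linear maps with $\xi_r(f^{2t}_i)=\delta_{ir}\cdot 1_A$ and $\eta_r(f^{2t}_i)=\delta_{ir}\cdot xy$. These maps are cocycles, and: (a) the classes of the $4t+2$ maps $\xi_0,\dots,\xi_{2t},\eta_0,\dots,\eta_{2t}$, taken with respect to this resolution, form a $k$-basis of $HH^{2t}(A)$; (b) the class of each $\eta_r$ is a nilpotent element of the ring $HH^*(A)$. -/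

import Mathlib

open CategoryTheory CategoryTheory.Abelian
open scoped TensorProduct DirectSum

universe u

noncomputable section

/-! ### Hochschild cohomology of an algebra over a field -/

/-- The enveloping algebra `B ⊗ Bᵒᵖ`. -/
def Env (k B : Type u) [Field k] [Ring B] [Algebra k B] : Type u := B ⊗[k] Bᵐᵒᵖ

instance (k B : Type u) [Field k] [Ring B] [Algebra k B] : Ring (Env k B) :=
  inferInstanceAs (Ring (B ⊗[k] Bᵐᵒᵖ))

instance (k B : Type u) [Field k] [Ring B] [Algebra k B] : Algebra k (Env k B) :=
  inferInstanceAs (Algebra k (B ⊗[k] Bᵐᵒᵖ))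

/-- The element `a ⊗ b` of the enveloping algebra. -/
def Env.tmul (k : Type u) {B : Type u} [Field k] [Ring B] [Algebra k B] (a b : B) : Env k B :=
  (a ⊗ₜ[k] MulOpposite.op b : B ⊗[k] Bᵐᵒᵖ)

theorem Env.tmul_mul_tmul (k : Type u) {B : Type u} [Field k] [Ring B] [Algebra k B]
    (a b c d : B) : Env.tmul k a b * Env.tmul k c d = Env.tmul k (a * c) (d * b) := by
  unfold Env.tmul
  exact Algebra.TensorProduct.tmul_mul_tmul (R := k) a c (MulOpposite.op b) (MulOpposite.op d)

theorem Env.neg_tmul (k : Type u) {B : Type u} [Field k] [Ring B] [Algebra k B]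
    (a b : B) : Env.tmul k (-a) b = - Env.tmul k a b :=
  TensorProduct.neg_tmul (R := k) a (MulOpposite.op b)

theorem Env.tmul_neg (k : Type u) {B : Type u} [Field k] [Ring B] [Algebra k B]
    (a b : B) : Env.tmul k a (-b) = - Env.tmul k a b :=
  TensorProduct.tmul_neg (R := k) a (MulOpposite.op b)

theorem Env.zero_tmul (k : Type u) {B : Type u} [Field k] [Ring B] [Algebra k B]
    (b : B) : Env.tmul k 0 b = 0 :=
  TensorProduct.zero_tmul (R := k) B (MulOpposite.op b)

theorem Env.tmul_zero (k : Type u) {B : Type u} [Field k] [Ring B] [Algebra k B]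
    (a : B) : Env.tmul k a 0 = 0 :=
  TensorProduct.tmul_zero (R := k) Bᵐᵒᵖ a

/-- The bimodule `B`, as an object of the category of left modules over `B ⊗ Bᵒᵖ`;
the action is `(a ⊗ b) • m = a * m * b` (see `env_tmul_smul`). -/
def bimod (k B : Type u) [Field k] [Ring B] [Algebra k B] : ModuleCat.{u} (Env k B) :=
  letI : Module (Env k B) B := instModuleTensorProductMop k B
  ModuleCat.of (Env k B) B

theorem env_tmul_smul (k B : Type u) [Field k] [Ring B] [Algebra k B] (a b : B) (m : bimod k B) :
    Env.tmul k a b • m = (show bimod k B from a * (show B from m) * b) :=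
  AlgHom.mulLeftRight_apply k B a (MulOpposite.op b) m

/-- The Hochschild cohomology `HHⁿ(B) = Extⁿ(B, B)` over `B ⊗ Bᵒᵖ`. -/
abbrev HH (k B : Type u) [Field k] [Ring B] [Algebra k B] (n : ℕ) : Type u :=
  Ext.{u} (bimod k B) (bimod k B) n

section HHRing

variable (k B : Type u) [Field k] [Ring B] [Algebra k B]

theorem HH_mk_comp {a b c : ℕ} (α : HH k B a) (β : HH k B b) (h : a + b = c) :
    GradedMonoid.mk (A := HH k B) (a + b) (Ext.comp α β rfl) =
      GradedMonoid.mk (A := HH k B) c (Ext.comp α β h) := by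
  subst h
  rfl

instance HH.instGMul : GradedMonoid.GMul (HH k B) where
  mul {i j} α β := Ext.comp α β (rfl : i + j = i + j)

instance HH.instGOne : GradedMonoid.GOne (HH k B) where
  one := Ext.mk₀ (𝟙 _)

instance HH.instGMonoid : GradedMonoid.GMonoid (HH k B) where
  one_mul := fun ⟨n, α⟩ =>
    (HH_mk_comp k B _ α (zero_add n)).trans (congrArg (GradedMonoid.mk n) (Ext.mk₀_id_comp α))
  mul_one := fun ⟨n, α⟩ =>
    (HH_mk_comp k B α _ (add_zero n)).trans (congrArg (GradedMonoid.mk n) (Ext.comp_mk₀_id α))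
  mul_assoc := fun ⟨a, α⟩ ⟨b, β⟩ ⟨c, γ⟩ => by
    refine (HH_mk_comp k B (Ext.comp α β rfl) γ (add_assoc a b c)).trans ?_
    exact congrArg (GradedMonoid.mk _) (Ext.comp_assoc α β γ rfl rfl (add_assoc a b c))

/-- The graded ring structure on Hochschild cohomology given by the Yoneda product. -/
instance HH.instGRing : DirectSum.GRing (HH k B) where
  __ := HH.instGMonoid k B
  mul_zero α := Ext.comp_zero α _ _ _ _
  zero_mul β := Ext.zero_comp _ _ β _ _
  mul_add α β γ := Ext.comp_add α β γ _
  add_mul α β γ := Ext.add_comp α β γ _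
  natCast n := n • Ext.mk₀ (𝟙 _)
  natCast_zero := zero_nsmul _
  natCast_succ n := succ_nsmul _ n
  intCast n := n • Ext.mk₀ (𝟙 _)
  intCast_ofNat n := natCast_zsmul _ n
  intCast_negSucc_ofNat n := negSucc_zsmul _ n

end HHRing

/-- The Hochschild cohomology ring `HH^*(B) = ⨁ₙ HHⁿ(B)` with the Yoneda product. -/
abbrev HHRing (k B : Type u) [Field k] [Ring B] [Algebra k B] : Type u := ⨁ n, HH k B n

/-! ### The quantum complete intersection -/

namespace QCI

variable (k : Type u) [Field k]

/-- The defining relations `X² = 0`, `XY + YX = 0`, `Y² = 0`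
(the two free generators are `X = ι 0`, `Y = ι 1`). -/
inductive Rel : FreeAlgebra k (Fin 2) → FreeAlgebra k (Fin 2) → Prop
  | xx : Rel (FreeAlgebra.ι k 0 * FreeAlgebra.ι k 0) 0
  | xy : Rel (FreeAlgebra.ι k 0 * FreeAlgebra.ι k 1 + FreeAlgebra.ι k 1 * FreeAlgebra.ι k 0) 0
  | yy : Rel (FreeAlgebra.ι k 1 * FreeAlgebra.ι k 1) 0

/-- The algebra `A = k⟨X, Y⟩ / (X², XY + YX, Y²)`. -/
def Alg : Type u := RingQuot (Rel k)

instance : Ring (Alg k) := inferInstanceAs (Ring (RingQuot (Rel k)))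

instance : Algebra k (Alg k) := inferInstanceAs (Algebra k (RingQuot (Rel k)))

/-- The quotient map `k⟨X, Y⟩ → A`. -/
def proj : FreeAlgebra k (Fin 2) →ₐ[k] Alg k := RingQuot.mkAlgHom k (Rel k)

theorem proj_rel {a b : FreeAlgebra k (Fin 2)} (h : Rel k a b) : proj k a = proj k b :=
  RingQuot.mkAlgHom_rel k h

/-- The residue class of `X`. -/
def x : Alg k := proj k (FreeAlgebra.ι k 0)

/-- The residue class of `Y`. -/
def y : Alg k := proj k (FreeAlgebra.ι k 1)

theorem x_mul_x : x k * x k = 0 := by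
  simpa [x] using proj_rel k (Rel.xx (k := k))

theorem y_mul_y : y k * y k = 0 := by
  simpa [y] using proj_rel k (Rel.yy (k := k))

theorem x_mul_y_add : x k * y k + y k * x k = 0 := by
  simpa [x, y] using proj_rel k (Rel.xy (k := k))

theorem y_mul_x : y k * x k = -(x k * y k) :=
  eq_neg_of_add_eq_zero_right (x_mul_y_add k)

/-- The enveloping algebra of `A`. -/
abbrev Ae : Type u := Env k (Alg k)

/-- `α_z = 1 ⊗ z - z ⊗ 1`. -/
def α (z : Alg k) : Ae k := Env.tmul k 1 z - Env.tmul k z 1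

/-- `β_z = 1 ⊗ z + z ⊗ 1`. -/
def β (z : Alg k) : Ae k := Env.tmul k 1 z + Env.tmul k z 1

/-- The free `Aᵉ`-module `Pₙ` of rank `n + 1`. -/
abbrev P (n : ℕ) : Type u := Fin (n + 1) →₀ Ae k

/-- The generator `f^n_i` of `Pₙ`, with the convention `f^n_i = 0` unless `0 ≤ i ≤ n`. -/
def f (n : ℕ) (i : ℤ) : P k n :=
  if h : 0 ≤ i ∧ i ≤ n then Finsupp.single ⟨i.toNat, by omega⟩ 1 else 0

/-- The value `d(f^{n+1}_i)` of the differential `d : P_{n+1} → P_n` on a generator. -/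
def dGen (n i : ℕ) : P k n :=
  if Even (n + 1) then (-1 : ℤ) ^ i • (β k (y k) • f k n i + β k (x k) • f k n (i - 1))
  else (-1 : ℤ) ^ i • (α k (y k) • f k n i - α k (x k) • f k n (i - 1))

/-- The differential `d : P_{n+1} → P_n`. -/
def d (n : ℕ) : P k (n + 1) →ₗ[Ae k] P k n :=
  Finsupp.linearCombination (Ae k) fun i : Fin (n + 2) => dGen k n i

theorem f_of_lt (n i : ℕ) (h : n < i) : f k n i = 0 := by
  simp [f, h]

theorem f_neg (n : ℕ) : f k n (-1) = 0 := by
  simp [f]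

theorem f_of_le (n i : ℕ) (h : i < n + 1) : f k n i = Finsupp.single ⟨i, h⟩ 1 := by
  simp [f, Nat.lt_succ_iff.mp h]

theorem linearCombination_f {M : Type u} [AddCommGroup M] [Module (Ae k) M] (n i : ℕ) (p : Fin (n + 1) → M) :
    Finsupp.linearCombination (Ae k) p (f k n i) = if h : i < n + 1 then p ⟨i, h⟩ else 0 := by
  split_ifs with h
  · rw [f_of_le k n i h, Finsupp.linearCombination_single, one_smul]
  · rw [f_of_lt k n i (by omega), map_zero]

theorem hom_ext {n : ℕ} {M : Type u} [AddCommGroup M] [Module (Ae k) M] {φ ψ : P k n →ₗ[Ae k] M}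
    (h : ∀ i : ℕ, φ (f k n i) = ψ (f k n i)) : φ = ψ := by
  refine Finsupp.lhom_ext' fun i => LinearMap.ext_ring ?_
  have := h i
  rw [f_of_le k n i i.2] at this
  exact this

theorem d_f (n i : ℕ) : d k n (f k (n + 1) i) = dGen k n i := by
  refine (linearCombination_f k (n + 1) i _).trans ?_
  split_ifs with h
  · rfl
  · have h1 : f k n i = 0 := f_of_lt k n i (by omega)
    have h2 : f k n (i - 1) = 0 := by
      rw [show (i - 1 : ℤ) = ((i - 1 : ℕ) : ℤ) by omega]
      exact f_of_lt k n _ (by omega)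
    rw [dGen, h1, h2]
    simp

theorem d_f_zero (n : ℕ) : d k n (f k (n + 1) 0) = dGen k n 0 := d_f k n 0

theorem α_mul_β_self (z : Alg k) (hz : z * z = 0) : α k z * β k z = 0 := by
  simp [α, β, sub_mul, mul_add, Env.tmul_mul_tmul, Env.tmul_zero, Env.zero_tmul, hz]

theorem β_mul_α_self (z : Alg k) (hz : z * z = 0) : β k z * α k z = 0 := by
  simp [α, β, add_mul, mul_sub, Env.tmul_mul_tmul, Env.tmul_zero, Env.zero_tmul, hz]

theorem αx_mul_βy : α k (x k) * β k (y k) = -(α k (y k) * β k (x k)) := by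
  simp only [α, β, sub_mul, mul_add, Env.tmul_mul_tmul,
    y_mul_x, Env.tmul_neg, Env.neg_tmul, one_mul, mul_one]
  abel

theorem βx_mul_αy : β k (x k) * α k (y k) = -(β k (y k) * α k (x k)) := by
  simp only [α, β, add_mul, mul_sub, Env.tmul_mul_tmul,
    y_mul_x, Env.tmul_neg, Env.neg_tmul, one_mul, mul_one]
  abel

theorem d_comp_d (n : ℕ) : d k n ∘ₗ d k (n + 1) = 0 := by
  refine hom_ext k fun i => ?_
  have hx := x_mul_x k
  have hy := y_mul_y k
  rw [LinearMap.comp_apply, d_f, LinearMap.zero_apply]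
  by_cases hn : Even (n + 1)
  · have hn' : ¬ Even (n + 1 + 1) := by simpa [Nat.even_add_one] using hn
    rcases i with _ | j
    · simp [dGen, hn', d_f_zero, hn, f_neg, smul_smul, α_mul_β_self, hy]
    · have e : ((j + 1 : ℕ) : ℤ) - 1 = j := by omega
      simp only [dGen, hn', if_false, map_zsmul, map_sub, map_smul, d_f, e, hn, if_true]
      rcases neg_one_pow_eq_or ℤ j with h | h <;>
      simp [pow_succ, h, smul_smul, smul_add, α_mul_β_self, hx, hy, αx_mul_βy]
  · have hn' : Even (n + 1 + 1) := by simpa [Nat.even_add_one] using hn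
    rcases i with _ | j
    · simp [dGen, hn', d_f_zero, hn, f_neg, smul_smul, β_mul_α_self, hy]
    · have e : ((j + 1 : ℕ) : ℤ) - 1 = j := by omega
      simp only [dGen, hn', if_false, map_zsmul, map_add, map_smul, d_f, e, hn, if_true]
      rcases neg_one_pow_eq_or ℤ j with h | h <;>
      simp [pow_succ, h, smul_smul, smul_sub, β_mul_α_self, hx, hy, βx_mul_αy]

/-- The `Aᵉ`-linear map `Pₙ → A` with `f^n_i ↦ p i`. -/
def cochain {n : ℕ} (p : Fin (n + 1) → Alg k) : P k n →ₗ[Ae k] bimod k (Alg k) :=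
  Finsupp.linearCombination (Ae k) (M := bimod k (Alg k)) p

theorem α_smul (z : Alg k) (m : bimod k (Alg k))
    (h : (show Alg k from m) * z = z * (show Alg k from m)) : α k z • m = 0 := by
  rw [α, sub_smul, env_tmul_smul, env_tmul_smul]
  refine sub_eq_zero.mpr ?_
  change 1 * _ * z = z * _ * 1
  rw [one_mul, mul_one]
  exact h

/-- A cochain of even degree with central values is a cocycle. -/
theorem d_comp_cochain {n : ℕ} (hn : Even n) (p : Fin (n + 1) → Alg k)
    (hx : ∀ i, p i * x k = x k * p i) (hy : ∀ i, p i * y k = y k * p i) :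
    cochain k p ∘ₗ d k n = 0 := by
  have key : ∀ (z : Alg k) (_ : ∀ i, p i * z = z * p i) (i : ℕ),
      α k z • cochain k p (f k n i) = 0 := by
    intro z hz i
    obtain ⟨q, hq⟩ : ∃ q : Fin (n + 1) → bimod k (Alg k), q = p := ⟨p, rfl⟩
    have : cochain k p (f k n i) = if h : i < n + 1 then q ⟨i, h⟩ else 0 := by
      subst hq
      exact linearCombination_f (M := bimod k (Alg k)) k n i q
    rw [this]
    by_cases h : i < n + 1
    · rw [dif_pos h]
      refine α_smul k z _ ?_
      subst hq
      exact hz _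
    · rw [dif_neg h, smul_zero]
  have hn' : ¬ Even (n + 1) := by simpa [Nat.even_add_one] using hn
  refine hom_ext k fun i => ?_
  rw [LinearMap.comp_apply, d_f, LinearMap.zero_apply]
  rcases i with _ | j
  · have := key (y k) hy 0
    rw [Nat.cast_zero] at this
    simp [dGen, hn', f_neg, this]
  · have e : ((j + 1 : ℕ) : ℤ) - 1 = j := by omega
    simp only [dGen, hn', if_false, map_zsmul, map_sub, map_smul, e, key _ hx, key _ hy,
      sub_zero, smul_zero]

/-- The complex `⋯ → P₂ → P₁ → P₀`. -/
def complex : ChainComplex (ModuleCat.{u} (Ae k)) ℕ := 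
  ChainComplex.of (fun n => ModuleCat.of (Ae k) (P k n)) (fun n => ModuleCat.ofHom (d k n))
    fun n => ModuleCat.hom_ext (d_comp_d k n)

theorem complex_d (n : ℕ) : (complex k).d (n + 1) n = ModuleCat.ofHom (d k n) :=
  ChainComplex.of_d (fun n => ModuleCat.of (Ae k) (P k n)) (fun n => ModuleCat.ofHom (d k n)) n

/-- The augmentation `P_• → A` given in degree `0` by the multiplication map
`P₀ = A ⊗ Aᵒᵖ → A`, that is, `f^0_0 ↦ 1`. -/
def augmentation : complex k ⟶ (ChainComplex.single₀ _).obj (bimod k (Alg k)) :=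
  (ChainComplex.toSingle₀Equiv (complex k) (bimod k (Alg k))).symm
    ⟨ModuleCat.ofHom (Y := bimod k (Alg k)) (cochain k (n := 0) fun _ => 1),
      (congrArg (· ≫ _) (complex_d k 0)).trans (ModuleCat.hom_ext
        (d_comp_cochain k (by simp) _ (by simp) (by simp)))⟩

instance projective_complex (n : ℕ) : Projective ((complex k).X n) :=
  inferInstanceAs (Projective (ModuleCat.of (Ae k) (P k n)))

/-- The projective resolution `P_• → A`, given that the augmentation is a quasi-isomorphism. -/
def resolution (h : QuasiIso (augmentation k)) : ProjectiveResolution (bimod k (Alg k)) where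
  complex := complex k
  π := augmentation k
  quasiIso := h

/-- The class in `HHⁿ(A)` of a cocycle `Pₙ → A`. -/
def cls (h : QuasiIso (augmentation k)) {n : ℕ} (φ : P k n →ₗ[Ae k] bimod k (Alg k))
    (hφ : φ ∘ₗ d k n = 0) : HH k (Alg k) n :=
  (resolution k h).extMk (ModuleCat.ofHom (Y := bimod k (Alg k)) φ) (n + 1) rfl
    ((congrArg (· ≫ _) (complex_d k n)).trans (ModuleCat.hom_ext hφ))

/-- The map `ξ_r : Pₙ → A` with `f^n_i ↦ δ_{ir} 1`. -/
def ξ {n : ℕ} (r : Fin (n + 1)) : P k n →ₗ[Ae k] bimod k (Alg k) :=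
  cochain k fun i => if i = r then 1 else 0

/-- The map `η_r : Pₙ → A` with `f^n_i ↦ δ_{ir} xy`. -/
def η {n : ℕ} (r : Fin (n + 1)) : P k n →ₗ[Ae k] bimod k (Alg k) :=
  cochain k fun i => if i = r then x k * y k else 0

theorem d_comp_ξ {n : ℕ} (hn : Even n) (r : Fin (n + 1)) : ξ k r ∘ₗ d k n = 0 := by
  refine d_comp_cochain k hn _ (fun i => ?_) (fun i => ?_) <;> split_ifs <;> simp

theorem d_comp_η {n : ℕ} (hn : Even n) (r : Fin (n + 1)) : η k r ∘ₗ d k n = 0 := by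
  refine d_comp_cochain k hn _ (fun i => ?_) (fun i => ?_) <;> split_ifs
  · rw [mul_assoc, y_mul_x, mul_neg, ← mul_assoc, x_mul_x]; simp
  · simp
  · rw [mul_assoc, y_mul_y, ← mul_assoc, y_mul_x, neg_mul, mul_assoc, y_mul_y]; simp
  · simp

end QCI

end

/-! Everything is computed in the basis `1, x, y, xy` of A. It spans because words can be
straightened with yx = -xy, and it is independent because A acts on k^4 by explicit 4×4 matrices.
Hence every element of A^e is uniquely 1⊗w₀ + x⊗w₁ + y⊗w₂ + xy⊗w₃.

Exactness. With γ_s(z) = 1⊗z + s(z⊗1), s = ±1, the components of d are right multiplications by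
γ_s(x) and γ_s(y), and s alternates with the degree. Comparing coefficients gives two facts about
left ideals of A^e: the left annihilator of γ_s(x) lies in A^e γ_{-s}(x) (`exists_eq_mul_γ_neg_x`),
and u γ_s(y) ∈ A^e γ_s(x) forces u ∈ A^e γ_{-s}(y) + A^e γ_{-s}(x) (`exists_eq_of_mul_γ_y_eq`). The
second starts and the first continues a zigzag that builds a preimage of a cycle one component at a
time (`exists_zigzag`). At the augmentation, A^e is the sum of the left ideal generated by α_x, α_y
and 1⊗A (`exists_eq_add_one_tmul`).

Basis. For even n the cocycle condition involves commutators with x and y, which see only the x- and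
y-coordinates of the values. Coboundaries into positive even degree come from anticommutators and
take values in the span of x and y. So the coordinates at 1 and xy are free and survive in
cohomology, while the remaining part of a cocycle is a coboundary once 2 is invertible
(`exists_comp_d_eq`).

Nilpotency. The element z = xy⊗1 is central in A^e with z² = 0, and the class of η_r is z times that
of ξ_r. The Yoneda product is bilinear over the centre, so the square of the class vanishes. -/

noncomputable section

namespace QCI

variable (k : Type u) [Field k]

/-! ### The basis 1, x, y, xy of A -/

/-- The matrices of left multiplication by `x` and `y` with respect to `1, x, y, xy`. -/
def genMatrix : Fin 2 → Matrix (Fin 4) (Fin 4) k :=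
  ![!![0, 0, 0, 0; 1, 0, 0, 0; 0, 0, 0, 0; 0, 0, 1, 0],
    !![0, 0, 0, 0; 0, 0, 0, 0; 1, 0, 0, 0; 0, -1, 0, 0]]

/-- The left regular representation of `A`. -/
def regularRep : Alg k →ₐ[k] Matrix (Fin 4) (Fin 4) k :=
  RingQuot.liftAlgHom k ⟨FreeAlgebra.lift k (genMatrix k), fun _ _ h => by
    cases h <;> ext i j <;> fin_cases i <;> fin_cases j <;>
      simp [genMatrix, Matrix.mul_apply, Fin.sum_univ_four]⟩

theorem regularRep_proj (b : FreeAlgebra k (Fin 2)) :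
    regularRep k (proj k b) = FreeAlgebra.lift k (genMatrix k) b :=
  RingQuot.liftAlgHom_mkAlgHom_apply k _ _ b

theorem regularRep_x : regularRep k (x k) = genMatrix k 0 := by
  rw [x, regularRep_proj, FreeAlgebra.lift_ι_apply]

theorem regularRep_y : regularRep k (y k) = genMatrix k 1 := by
  rw [y, regularRep_proj, FreeAlgebra.lift_ι_apply]

/-- The coordinates of an element of `A` with respect to `1, x, y, xy`. -/
def coord (m : Fin 4) : Alg k →ₗ[k] k :=
  (Matrix.entryLinearMap k k m 0) ∘ₗ (regularRep k).toLinearMap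

theorem coord_apply (m : Fin 4) (a : Alg k) : coord k m a = regularRep k a m 0 := rfl

theorem coord_one (m : Fin 4) : coord k m 1 = if m = 0 then 1 else 0 := by
  rw [coord_apply, map_one, Matrix.one_apply]

theorem coord_x (m : Fin 4) : coord k m (x k) = if m = 1 then 1 else 0 := by
  rw [coord_apply, regularRep_x]
  fin_cases m <;> simp [genMatrix]

theorem coord_y (m : Fin 4) : coord k m (y k) = if m = 2 then 1 else 0 := by
  rw [coord_apply, regularRep_y]
  fin_cases m <;> simp [genMatrix]

theorem coord_xy (m : Fin 4) : coord k m (x k * y k) = if m = 3 then 1 else 0 := by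
  rw [coord_apply, map_mul, regularRep_x, regularRep_y]
  fin_cases m <;> simp [genMatrix, Matrix.mul_apply, Fin.sum_univ_four]

theorem x_mul_x_mul (a : Alg k) : x k * (x k * a) = 0 := by
  rw [← mul_assoc, x_mul_x, zero_mul]

theorem y_mul_x_mul (a : Alg k) : y k * (x k * a) = -(x k * (y k * a)) := by
  rw [← mul_assoc, y_mul_x, neg_mul, mul_assoc]

/-- The spanning half: the span of the four monomials contains the generators and is closed under
products by yx = -xy. Uniqueness comes from `coord`, which reads off the image of 1 (column 0) in
the regular representation. -/
theorem exists_eq_sum (a : Alg k) : ∃ c₀ c₁ c₂ c₃ : k,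
    a = c₀ • (1 : Alg k) + c₁ • x k + c₂ • y k + c₃ • (x k * y k) := by
  obtain ⟨b, rfl⟩ : ∃ b, proj k b = a := RingQuot.mkAlgHom_surjective k (Rel k) a
  induction b using FreeAlgebra.induction with
  | grade0 r => exact ⟨r, 0, 0, 0, by simp [Algebra.algebraMap_eq_smul_one]⟩
  | grade1 i =>
    fin_cases i
    · exact ⟨0, 1, 0, 0, by simp [x]⟩
    · exact ⟨0, 0, 1, 0, by simp [y]⟩
  | mul a b ha hb =>
    obtain ⟨a₀, a₁, a₂, a₃, ha⟩ := ha
    obtain ⟨b₀, b₁, b₂, b₃, hb⟩ := hb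
    refine ⟨a₀ * b₀, a₀ * b₁ + a₁ * b₀, a₀ * b₂ + a₂ * b₀,
      a₀ * b₃ + a₃ * b₀ + a₁ * b₂ - a₂ * b₁, ?_⟩
    rw [map_mul, ha, hb]
    simp only [mul_add, add_mul, smul_mul_smul_comm, mul_one, one_mul, mul_assoc, x_mul_x,
      y_mul_y, y_mul_x, x_mul_x_mul, y_mul_x_mul, mul_neg, mul_zero, neg_zero, smul_zero]
    module
  | add a b ha hb =>
    obtain ⟨a₀, a₁, a₂, a₃, ha⟩ := ha
    obtain ⟨b₀, b₁, b₂, b₃, hb⟩ := hb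
    refine ⟨a₀ + b₀, a₁ + b₁, a₂ + b₂, a₃ + b₃, ?_⟩
    rw [map_add, ha, hb]
    module

theorem eq_sum_coord (a : Alg k) : a = coord k 0 a • (1 : Alg k) + coord k 1 a • x k +
    coord k 2 a • y k + coord k 3 a • (x k * y k) := by
  obtain ⟨c₀, c₁, c₂, c₃, rfl⟩ := exists_eq_sum k a
  simp [coord_one, coord_x, coord_y, coord_xy]

/-! ### Coefficients in the enveloping algebra -/

/-- The coefficients in `A` of an element of `Aᵉ = A ⊗ Aᵒᵖ` with respect to the basis
`1, x, y, xy` of the left factor. -/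
def coeff (m : Fin 4) : Ae k →ₗ[k] Alg k :=
  (MulOpposite.opLinearEquiv k).symm.toLinearMap ∘ₗ (TensorProduct.lid k _).toLinearMap ∘ₗ
    LinearMap.rTensor (Alg k)ᵐᵒᵖ (coord k m)

theorem coeff_tmul (m : Fin 4) (a b : Alg k) :
    coeff k m (Env.tmul k a b) = coord k m a • b := by
  change (MulOpposite.opLinearEquiv k).symm (TensorProduct.lid k _
    (LinearMap.rTensor (Alg k)ᵐᵒᵖ (coord k m) (a ⊗ₜ[k] MulOpposite.op b))) = _
  simp

theorem tmul_add (a b c : Alg k) :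
    Env.tmul k a (b + c) = Env.tmul k a b + Env.tmul k a c :=
  TensorProduct.tmul_add (R := k) a (MulOpposite.op b) (MulOpposite.op c)

theorem add_tmul (a b c : Alg k) :
    Env.tmul k (a + b) c = Env.tmul k a c + Env.tmul k b c :=
  TensorProduct.add_tmul (R := k) a b (MulOpposite.op c)

theorem smul_tmul (r : k) (a c : Alg k) :
    Env.tmul k (r • a) c = Env.tmul k a (r • c) :=
  TensorProduct.smul_tmul (R := k) r a (MulOpposite.op c)

theorem env_induction {motive : Ae k → Prop} (u : Ae k) (zero : motive 0)
    (tmul : ∀ a b, motive (Env.tmul k a b))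
    (add : ∀ v w, motive v → motive w → motive (v + w)) : motive u :=
  TensorProduct.induction_on (R := k) (M := Alg k) (N := (Alg k)ᵐᵒᵖ) (motive := motive) u zero
    (fun a b => tmul a b.unop) add

theorem exists_eq_sum_tmul (u : Ae k) : ∃ w₀ w₁ w₂ w₃ : Alg k,
    u = Env.tmul k 1 w₀ + Env.tmul k (x k) w₁ + Env.tmul k (y k) w₂ +
      Env.tmul k (x k * y k) w₃ := by
  induction u using env_induction with
  | zero => exact ⟨0, 0, 0, 0, by simp [Env.tmul_zero]⟩
  | tmul a b =>
    refine ⟨coord k 0 a • b, coord k 1 a • b, coord k 2 a • b, coord k 3 a • b, ?_⟩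
    rw [← smul_tmul, ← smul_tmul, ← smul_tmul, ← smul_tmul, ← add_tmul, ← add_tmul, ← add_tmul,
      ← eq_sum_coord]
  | add v w hv hw =>
    obtain ⟨a₀, a₁, a₂, a₃, rfl⟩ := hv
    obtain ⟨b₀, b₁, b₂, b₃, rfl⟩ := hw
    refine ⟨a₀ + b₀, a₁ + b₁, a₂ + b₂, a₃ + b₃, ?_⟩
    simp only [tmul_add]
    abel

theorem sum_tmul_inj {a₀ a₁ a₂ a₃ b₀ b₁ b₂ b₃ : Alg k}
    (h : Env.tmul k 1 a₀ + Env.tmul k (x k) a₁ + Env.tmul k (y k) a₂ +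
      Env.tmul k (x k * y k) a₃ = Env.tmul k 1 b₀ + Env.tmul k (x k) b₁ + Env.tmul k (y k) b₂ +
      Env.tmul k (x k * y k) b₃) : a₀ = b₀ ∧ a₁ = b₁ ∧ a₂ = b₂ ∧ a₃ = b₃ := by
  have key (m : Fin 4) := congrArg (coeff k m) h
  simp only [map_add, coeff_tmul, coord_one, coord_x, coord_y, coord_xy] at key
  refine ⟨?_, ?_, ?_, ?_⟩
  · simpa using key 0
  · simpa using key 1
  · simpa using key 2
  · simpa using key 3

/-! ### Left ideals of A^e generated by γ_s(x) and γ_s(y) -/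

/-- The element `1 ⊗ z + s (z ⊗ 1)`, which is `α_z` for `s = -1` and `β_z` for `s = 1`. -/
def γ (s : ℤ) (z : Alg k) : Ae k := Env.tmul k 1 z + s • Env.tmul k z 1

theorem γ_one (z : Alg k) : γ k 1 z = β k z := by simp [γ, β]

theorem γ_neg_one (z : Alg k) : γ k (-1) z = α k z := by simp [γ, α, sub_eq_add_neg]

theorem tmul_mul_γ (s : ℤ) (a b z : Alg k) :
    Env.tmul k a b * γ k s z = Env.tmul k a (z * b) + s • Env.tmul k (a * z) b := by
  rw [γ, mul_add, mul_smul_comm, Env.tmul_mul_tmul, Env.tmul_mul_tmul, mul_one, one_mul]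

theorem γ_mul_γ_neg_self {s : ℤ} (hs : s = 1 ∨ s = -1) (z : Alg k) (hz : z * z = 0) :
    γ k s z * γ k (-s) z = 0 := by
  rcases hs with rfl | rfl
  · rw [γ_one, γ_neg_one, β_mul_α_self k z hz]
  · rw [neg_neg, γ_one, γ_neg_one, α_mul_β_self k z hz]

theorem γ_x_mul_γ_neg_y {s : ℤ} (hs : s = 1 ∨ s = -1) :
    γ k s (x k) * γ k (-s) (y k) = -(γ k s (y k) * γ k (-s) (x k)) := by
  rcases hs with rfl | rfl
  · rw [γ_one, γ_neg_one, γ_one, γ_neg_one, βx_mul_αy]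
  · rw [neg_neg, γ_one, γ_neg_one, γ_one, γ_neg_one, αx_mul_βy]

theorem sum_tmul_mul_γ_x (s : ℤ) (w₀ w₁ w₂ w₃ : Alg k) :
    (Env.tmul k 1 w₀ + Env.tmul k (x k) w₁ + Env.tmul k (y k) w₂ +
      Env.tmul k (x k * y k) w₃) * γ k s (x k) =
    Env.tmul k 1 (x k * w₀) + Env.tmul k (x k) (x k * w₁ + s • w₀) +
      Env.tmul k (y k) (x k * w₂) + Env.tmul k (x k * y k) (x k * w₃ - s • w₂) := by
  have h (a b : Alg k) : Env.tmul k a (s • b) = s • Env.tmul k a b :=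
    map_zsmul (AddMonoidHom.mk' (Env.tmul k a) (tmul_add k a)) s b
  simp only [add_mul, tmul_mul_γ, one_mul, x_mul_x, y_mul_x, mul_assoc, mul_neg, x_mul_x_mul,
    Env.zero_tmul, Env.neg_tmul, tmul_add, sub_eq_add_neg, Env.tmul_neg, h, neg_zero, smul_zero,
    smul_neg]
  abel

/-- The coefficients of u γ_s(x) at x and xy determine w₀ and w₂ from w₁ and w₃, so u has the shape
of a multiple of γ_{-s}(x). -/
theorem exists_eq_mul_γ_neg_x {s : ℤ} (hs : s = 1 ∨ s = -1) {u : Ae k} (h : u * γ k s (x k) = 0) :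
    ∃ v, u = v * γ k (-s) (x k) := by
  obtain ⟨w₀, w₁, w₂, w₃, rfl⟩ := exists_eq_sum_tmul k u
  rw [sum_tmul_mul_γ_x] at h
  obtain ⟨-, h₁, -, h₃⟩ := sum_tmul_inj k (b₀ := 0) (b₁ := 0) (b₂ := 0) (b₃ := 0)
    (h.trans (by simp [Env.tmul_zero]))
  -- The factor is chosen so that its product with γ_{-s}(x) has coefficients w₁ at x and w₃ at xy;
  -- the two relations then match w₀ and w₂.
  refine ⟨Env.tmul k 1 (-(s • w₁)) + Env.tmul k (y k) (s • w₃), ?_⟩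
  rw [add_mul, tmul_mul_γ, tmul_mul_γ]
  rcases hs with rfl | rfl
  · obtain rfl : w₀ = -(x k * w₁) := by
      rw [one_smul] at h₁
      exact eq_neg_of_add_eq_zero_right h₁
    obtain rfl : w₂ = x k * w₃ := by
      rw [one_smul, sub_eq_zero] at h₃
      exact h₃.symm
    simp only [one_smul, neg_smul, mul_neg, Env.tmul_neg, one_mul, y_mul_x, Env.neg_tmul]
    abel
  · obtain rfl : w₀ = x k * w₁ := by
      rw [neg_smul, one_smul, ← sub_eq_add_neg, sub_eq_zero] at h₁
      exact h₁.symm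
    obtain rfl : w₂ = -(x k * w₃) := by
      rw [neg_smul, one_smul, sub_neg_eq_add] at h₃
      exact eq_neg_of_add_eq_zero_right h₃
    simp only [one_smul, neg_smul, mul_neg, Env.tmul_neg, one_mul, y_mul_x, Env.neg_tmul, neg_neg]
    abel

theorem exists_eq_add_one_tmul {s : ℤ} (hs : s = 1 ∨ s = -1) (u : Ae k) :
    ∃ v w a, u = v * γ k s (y k) + w * γ k s (x k) + Env.tmul k 1 a := by
  obtain ⟨w₀, w₁, w₂, w₃, rfl⟩ := exists_eq_sum_tmul k u
  -- Modulo the left ideal, a z on the left moves to the right factor at the cost of -s. The term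
  -- xy⊗w₃ is moved in two steps, first y and then x, which accounts for the correction by 1⊗y w₃.
  refine ⟨Env.tmul k 1 (s • w₂) + Env.tmul k (x k) (s • w₃),
    Env.tmul k 1 (s • w₁) - Env.tmul k 1 (y k * w₃),
    w₀ - s • (x k * w₁) - s • (y k * w₂) + x k * (y k * w₃), ?_⟩
  rw [add_mul, sub_mul, tmul_mul_γ, tmul_mul_γ, tmul_mul_γ, tmul_mul_γ]
  rcases hs with rfl | rfl <;>
  simp only [one_smul, neg_smul, mul_neg, Env.tmul_neg, one_mul, tmul_add,
    sub_eq_add_neg, neg_neg] <;>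
  abel

/-- Right multiplication by γ_s(y) sends the target left ideal into A^e γ_s(x), by γ_{-s}(y) γ_s(y)
= 0 and the anticommutation of the x- and y-factors. So u may be replaced by its remainder 1⊗a, and
it suffices that a = 0. -/
theorem exists_eq_of_mul_γ_y_eq {s : ℤ} (hs : s = 1 ∨ s = -1) {u v : Ae k}
    (h : u * γ k s (y k) = v * γ k s (x k)) :
    ∃ v w, u = v * γ k (-s) (y k) + w * γ k (-s) (x k) := by
  have hs' : -s = 1 ∨ -s = -1 := by omega
  obtain ⟨p, q, a, rfl⟩ := exists_eq_add_one_tmul k hs' u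
  suffices a = 0 from ⟨p, q, by rw [this, Env.tmul_zero, add_zero]⟩
  have hy := γ_mul_γ_neg_self k hs' (y k) (y_mul_y k)
  have hx := γ_x_mul_γ_neg_y k hs'
  rw [neg_neg] at hx hy
  have h' : Env.tmul k 1 a * γ k s (y k) = (v + q * γ k (-s) (y k)) * γ k s (x k) := by
    rw [add_mul, ← h, add_mul, add_mul, mul_assoc, mul_assoc, mul_assoc, hy, hx]
    simp
  obtain ⟨w₀, w₁, w₂, w₃, hw⟩ := exists_eq_sum_tmul k (v + q * γ k (-s) (y k))
  have hsa : s • Env.tmul k (y k) a = Env.tmul k (y k) (s • a) :=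
    (map_zsmul (AddMonoidHom.mk' (Env.tmul k (y k)) (tmul_add k (y k))) s a).symm
  rw [hw, sum_tmul_mul_γ_x, tmul_mul_γ, one_mul, hsa] at h'
  -- The coefficients at y and xy say s a = x w₂ and s w₂ = x w₃, so a = x(x w₃) = 0.
  obtain ⟨-, -, h₂, h₃⟩ := sum_tmul_inj k (a₀ := y k * a) (a₁ := 0) (a₂ := s • a) (a₃ := 0)
    (Eq.trans (by simp [Env.tmul_zero]) h')
  rcases hs with rfl | rfl
  · rw [one_smul] at h₂ h₃
    rw [h₂, ← sub_eq_zero.mp h₃.symm, x_mul_x_mul]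
  · rw [neg_smul, one_smul] at h₂ h₃
    rw [sub_neg_eq_add] at h₃
    rw [← neg_neg a, h₂, eq_neg_of_add_eq_zero_right h₃.symm, mul_neg, x_mul_x_mul, neg_zero,
      neg_zero]

/-! ### Exactness of the resolution -/

/-- The sign distinguishing the two forms of the differential `P_{n+1} → P_n`. -/
def dSign (n : ℕ) : ℤ := (-1) ^ (n + 1)

theorem dSign_zero : dSign 0 = -1 := rfl

theorem dSign_succ (n : ℕ) : dSign (n + 1) = -dSign n := by
  rw [dSign, pow_succ, mul_neg_one, dSign]

theorem dSign_eq_or (n : ℕ) : dSign n = 1 ∨ dSign n = -1 := neg_one_pow_eq_or ℤ _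

theorem dGen_eq (n i : ℕ) : dGen k n i = (-1 : ℤ) ^ i • (γ k (dSign n) (y k) • f k n i +
    dSign n • γ k (dSign n) (x k) • f k n (i - 1)) := by
  unfold dGen dSign
  split_ifs with h
  · rw [h.neg_one_pow, γ_one, γ_one, one_smul]
  · rw [(Nat.not_even_iff_odd.mp h).neg_one_pow, γ_neg_one, γ_neg_one, neg_smul, one_smul,
      sub_eq_add_neg]

theorem f_apply (n : ℕ) (i : ℤ) (j : Fin (n + 1)) :
    f k n i j = if i = j then 1 else 0 := by
  unfold f
  split_ifs with h₁ h₂ h₂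
  · rw [Finsupp.single_apply, if_pos (Fin.ext (by simp [h₂]))]
  · rw [Finsupp.single_apply, if_neg]
    rintro rfl
    exact h₂ (by simp [h₁.1])
  · omega
  · rfl

/-- Since d is left linear, it acts on components by right multiplication; this turns exactness into
statements about left ideals. The minus sign comes from (-1)^(i+1) in the contribution of f_{i+1}.
-/
theorem d_apply (n : ℕ) (v : P k (n + 1)) (i : Fin (n + 1)) :
    d k n v i = (-1 : ℤ) ^ (i : ℕ) • (v i.castSucc * γ k (dSign n) (y k) -
      dSign n • (v i.succ * γ k (dSign n) (x k))) := by
  induction v using Finsupp.induction_linear with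
  | zero => simp
  | add v w hv hw =>
    rw [map_add, Finsupp.add_apply, hv, hw]
    simp only [Finsupp.add_apply, add_mul, smul_add, smul_sub]
    abel
  | single j b =>
    rw [d, Finsupp.linearCombination_single, Finsupp.smul_apply, dGen_eq]
    simp only [Finsupp.smul_apply, Finsupp.add_apply, f_apply, Finsupp.single_apply, smul_eq_mul]
    by_cases h₁ : j = i.castSucc
    · subst h₁
      have : (i.castSucc : Fin (n + 2)) ≠ i.succ := by simp [Fin.ext_iff]
      simp [this, -zsmul_eq_mul]
    · have h₁' : ((j : ℕ) : ℤ) ≠ (i : ℕ) := fun h => h₁ (Fin.ext (by simpa using h))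
      by_cases h₂ : j = i.succ
      · subst h₂
        simp [h₁, pow_succ, -zsmul_eq_mul]
      · have h₂' : ((j : ℕ) : ℤ) - 1 ≠ (i : ℕ) := fun h => h₂ (Fin.ext (by simp; omega))
        simp [h₁, h₁', h₂, h₂']

/-- The recursive construction of a preimage under the differential, component by component. -/
theorem exists_zigzag {s : ℤ} (hs : s = 1 ∨ s = -1) (m : ℕ) (U : ℕ → Ae k)
    (hU : ∀ i < m + 1, U i * γ k s (y k) = s • (U (i + 1) * γ k s (x k))) :
    ∀ j ≤ m + 1, ∃ V : ℕ → Ae k, ∀ i ≤ j, U i = (-1 : ℤ) ^ i • (V i * γ k (-s) (y k) +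
      s • (V (i + 1) * γ k (-s) (x k))) := by
  have hs' : -s = 1 ∨ -s = -1 := by omega
  have hss : s * s = 1 := by rcases hs with rfl | rfl <;> rfl
  have hy := γ_mul_γ_neg_self k hs' (y k) (y_mul_y k)
  have hx := γ_x_mul_γ_neg_y k hs'
  rw [neg_neg] at hx hy
  intro j
  induction j with
  | zero =>
    intro _
    obtain ⟨v, w, h⟩ := exists_eq_of_mul_γ_y_eq k hs
      ((hU 0 (by omega)).trans (smul_mul_assoc s (U 1) _).symm)
    -- Only V 0 and V 1 matter here; the factor s on w cancels the one in the formula, as s² = 1.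
    refine ⟨fun i => if i = 0 then v else s • w, fun i hi => ?_⟩
    obtain rfl : i = 0 := by omega
    simp [h, smul_smul, hss, -zsmul_eq_mul]
  | succ j ih =>
    intro hj
    obtain ⟨V, hV⟩ := ih (by omega)
    -- V (j + 1) is already fixed, so only the γ_{-s}(x)-term is still to be found. The cycle
    -- relation and anticommutation show that the difference is killed by γ_s(x).
    obtain ⟨w, hw⟩ : ∃ w, U (j + 1) - (-1 : ℤ) ^ (j + 1) • (V (j + 1) * γ k (-s) (y k)) =
        w * γ k (-s) (x k) := by
      refine exists_eq_mul_γ_neg_x k hs ?_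
      have h₁ : U (j + 1) * γ k s (x k) = s • (U j * γ k s (y k)) := by
        rw [hU j (by omega), smul_smul, hss, one_smul]
      rw [sub_mul, h₁, hV j le_rfl, smul_mul_assoc, smul_mul_assoc, add_mul, smul_mul_assoc,
        mul_assoc, mul_assoc, mul_assoc, hy, hx, mul_zero, zero_add, smul_comm, smul_smul s s, hss,
        one_smul, mul_neg, pow_succ, mul_neg_one, neg_smul, smul_neg, sub_self]
    -- The new entry absorbs its own sign: (-1)^(j+1) s squares to 1. Earlier equations do not
    -- involve index j + 2.
    refine ⟨fun i => if i = j + 2 then ((-1 : ℤ) ^ (j + 1) * s) • w else V i, fun i hi => ?_⟩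
    beta_reduce
    rcases Nat.lt_or_ge j i with h | h
    · obtain rfl : i = j + 1 := by omega
      have e : (-1 : ℤ) ^ (j + 1) * s * ((-1) ^ (j + 1) * s) = 1 := by
        rw [mul_mul_mul_comm, hss, ← mul_pow]
        norm_num
      rw [if_neg (by omega), if_pos rfl, smul_add, smul_smul, smul_mul_assoc, smul_smul, e,
        one_smul, ← hw]
      abel
    · rw [if_neg (by omega), if_neg (by omega)]
      exact hV i h

theorem exists_d_eq_of_d_eq_zero (m : ℕ) (p : P k (m + 1)) (h : d k m p = 0) :
    ∃ q, d k (m + 1) q = p := by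
  have hs := dSign_eq_or m
  obtain ⟨V, hV⟩ := exists_zigzag k hs m (fun i => if h : i < m + 2 then p ⟨i, h⟩ else 0)
    (fun i hi => by
      have := congrArg (fun q : P k m => q ⟨i, hi⟩) h
      rw [d_apply] at this
      rw [dif_pos (by omega), dif_pos (by omega)]
      rcases neg_one_pow_eq_or ℤ i with e | e <;>
      · simp only [e, Finsupp.zero_apply, one_smul, neg_smul, neg_eq_zero] at this
        exact sub_eq_zero.mp this) (m + 1) le_rfl
  refine ⟨Finsupp.equivFunOnFinite.symm fun i : Fin (m + 3) => V i, Finsupp.ext fun i => ?_⟩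
  have := hV i (by omega)
  rw [dif_pos i.2] at this
  rw [d_apply, dSign_succ]
  simpa using this.symm

/-- Both γ_{-1}(x) = α_x and γ_{-1}(y) = α_y annihilate 1 ∈ A, so the augmentation sees only the
remainder 1⊗a. -/
theorem cochain_zero_one_apply (p : P k 0) (v w : Ae k) (a : Alg k)
    (h : p 0 = v * γ k (-1) (y k) + w * γ k (-1) (x k) + Env.tmul k 1 a) :
    cochain k (n := 0) (fun _ => 1) p = a := by
  have hp : p = Finsupp.single 0 (p 0) := by
    ext i
    fin_cases i
    simp
  obtain ⟨e, he⟩ : ∃ e : bimod k (Alg k), e = (1 : Alg k) := ⟨(1 : Alg k), rfl⟩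
  have hγ (z : Alg k) : γ k (-1) z • e = 0 := by
    rw [γ_neg_one, he]
    exact α_smul k z _ ((one_mul z).trans (mul_one z).symm)
  have h₁ : Env.tmul k 1 a • e = a := by
    rw [he]
    exact (env_tmul_smul k (Alg k) 1 a _).trans
      ((congrArg (· * a) (one_mul (1 : Alg k))).trans (one_mul a))
  have h₂ : cochain k (n := 0) (fun _ => 1) p = p 0 • e := by
    rw [hp, he]
    exact (Finsupp.linearCombination_single _ _ _).trans (by rw [Finsupp.single_eq_same])
  rw [h₂, h, add_smul, add_smul, mul_smul, mul_smul, hγ, hγ, smul_zero, smul_zero, zero_add,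
    zero_add, h₁]

theorem exists_d_eq_of_cochain_eq_zero (p : P k 0)
    (h : cochain k (n := 0) (fun _ => 1) p = 0) : ∃ q, d k 0 q = p := by
  obtain ⟨v, w, a, hp⟩ := exists_eq_add_one_tmul k (Or.inr rfl) (p 0)
  obtain rfl : a = 0 := (cochain_zero_one_apply k p v w a hp).symm.trans h
  refine ⟨Finsupp.equivFunOnFinite.symm ![v, w], Finsupp.ext fun i => ?_⟩
  rw [Env.tmul_zero, add_zero] at hp
  fin_cases i
  rw [d_apply, dSign_zero]
  simpa using hp.symm

theorem cochain_zero_one_surjective :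
    Function.Surjective (cochain k (n := 0) fun _ => 1) := fun a =>
  ⟨Finsupp.single 0 (Env.tmul k 1 a), cochain_zero_one_apply k _ 0 0 a (by simp)⟩

theorem exact_d (m : ℕ) : (ShortComplex.mk (ModuleCat.ofHom (d k (m + 1)))
    (ModuleCat.ofHom (d k m)) (ModuleCat.hom_ext (d_comp_d k m))).Exact :=
  (ShortComplex.moduleCat_exact_iff _).mpr fun p hp => exists_d_eq_of_d_eq_zero k m p hp

theorem exact_of_eq {C : Type*} [Category* C] [Limits.HasZeroMorphisms C] {X Y Z : C}
    {f f' : X ⟶ Y} {g g' : Y ⟶ Z} (hf : f = f') (hg : g = g') (w : f ≫ g = 0) (w' : f' ≫ g' = 0)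
    (h : (ShortComplex.mk f' g' w').Exact) : (ShortComplex.mk f g w).Exact := by
  subst hf hg
  exact h

theorem exactAt_complex (m : ℕ) : (complex k).ExactAt (m + 1) := by
  rw [HomologicalComplex.exactAt_iff' _ (m + 2) (m + 1) m (by simp) (by simp)]
  exact exact_of_eq (complex_d k (m + 1)) (complex_d k m) _ _ (exact_d k m)

theorem quasiIso_augmentation : QuasiIso (augmentation k) where
  quasiIsoAt m := by
    cases m with
    | zero =>
      rw [ChainComplex.quasiIsoAt₀_iff, ShortComplex.quasiIso_iff_of_zeros' _ rfl rfl rfl]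
      constructor
      · refine exact_of_eq (complex_d k 0)
          (ChainComplex.toSingle₀Equiv_symm_apply_f_zero _ _) _
          (ModuleCat.hom_ext (d_comp_cochain k (by simp) _ (by simp) (by simp))) ?_
        rw [ShortComplex.moduleCat_exact_iff]
        exact fun p hp => exists_d_eq_of_cochain_eq_zero k p hp
      · rw [ModuleCat.epi_iff_surjective]
        exact cochain_zero_one_surjective k
    | succ m =>
      rw [quasiIsoAt_iff_exactAt' (hL := ChainComplex.exactAt_succ_single_obj ..)]
      exact exactAt_complex k m

/-! ### Nilpotency of the classes of the η_r -/

theorem xy_mul_comm (a : Alg k) : x k * y k * a = a * (x k * y k) := by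
  obtain ⟨c₀, c₁, c₂, c₃, rfl⟩ := exists_eq_sum k a
  simp [mul_add, add_mul, mul_assoc, y_mul_y, y_mul_x, x_mul_x_mul, y_mul_x_mul]

theorem cls_congr (h : QuasiIso (augmentation k)) {n : ℕ} {φ ψ : P k n →ₗ[Ae k] bimod k (Alg k)}
    (hφ : φ ∘ₗ d k n = 0) (hψ : ψ ∘ₗ d k n = 0) (e : φ = ψ) : cls k h φ hφ = cls k h ψ hψ := by
  subst e
  rfl

theorem cls_comp_mk₀ (h : QuasiIso (augmentation k)) {n : ℕ}
    (φ ψ : P k n →ₗ[Ae k] bimod k (Alg k)) (hφ : φ ∘ₗ d k n = 0) (hψ : ψ ∘ₗ d k n = 0)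
    (g : bimod k (Alg k) ⟶ bimod k (Alg k)) (e : g.hom ∘ₗ φ = ψ) :
    (cls k h φ hφ).comp (Ext.mk₀ g) (add_zero n) = cls k h ψ hψ := by
  subst e
  exact (resolution k h).extMk_comp_mk₀ (ModuleCat.ofHom (Y := bimod k (Alg k)) φ) (n + 1) rfl
    ((congrArg (· ≫ _) (complex_d k n)).trans (ModuleCat.hom_ext hφ)) g

theorem cochain_f {n : ℕ} (p : Fin (n + 1) → Alg k) (i : Fin (n + 1)) :
    cochain k p (Finsupp.single i 1) = p i :=
  (Finsupp.linearCombination_single _ _ _).trans (one_smul _ _)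

-- The class of η_r is z times that of ξ_r for z = xy⊗1, a central element of square zero; by
-- bilinearity over the centre, exponent 2 suffices.
open scoped ModuleCat.Algebra in
theorem isNilpotent_cls_η (h : QuasiIso (augmentation k)) {n : ℕ} (hn : Even n)
    (r : Fin (n + 1)) : IsNilpotent (DirectSum.of (HH k (Alg k)) n
      (cls k h (η k r) (d_comp_η k hn r)) : HHRing k (Alg k)) := by
  have hz : Env.tmul k (x k * y k) 1 ∈ Subring.center (Ae k) := by
    rw [Subring.mem_center_iff]
    intro u
    induction u using env_induction with
    | zero => rw [zero_mul, mul_zero]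
    | tmul a b => rw [Env.tmul_mul_tmul, Env.tmul_mul_tmul, xy_mul_comm, one_mul, mul_one]
    | add v w hv hw => rw [add_mul, mul_add, hv, hw]
  obtain ⟨z, hzz⟩ : ∃ z : Subring.center (Ae k), (z : Ae k) = Env.tmul k (x k * y k) 1 :=
    ⟨⟨_, hz⟩, rfl⟩
  have hz2 : z * z = 0 := by
    refine Subtype.ext ?_
    change (z : Ae k) * z = 0
    rw [hzz, Env.tmul_mul_tmul, xy_mul_comm, mul_assoc, ← mul_assoc (y k), y_mul_x, neg_mul,
      mul_assoc, y_mul_y]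
    simp [Env.zero_tmul]
  have hη : cls k h (η k r) (d_comp_η k hn r) = z • cls k h (ξ k r) (d_comp_ξ k hn r) := by
    rw [Ext.smul_eq_comp_mk₀]
    refine (cls_comp_mk₀ k h _ _ _ _ _ (Finsupp.lhom_ext' fun i => LinearMap.ext_ring ?_)).symm
    change (z : Ae k) • ξ k r (Finsupp.single i 1) = η k r (Finsupp.single i 1)
    rw [hzz, ξ, η, cochain_f, cochain_f]
    refine (env_tmul_smul k (Alg k) _ _ _).trans ?_
    change x k * y k * (if i = r then 1 else 0) * 1 = _
    split_ifs <;> simp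
  refine ⟨2, ?_⟩
  rw [pow_two, DirectSum.of_mul_of]
  refine (congrArg _ ?_).trans (map_zero _)
  change Ext.comp _ _ rfl = 0
  rw [hη, Ext.comp_smul, Ext.smul_comp, smul_smul, hz2, zero_smul]

end QCI

end

/-! ### Degree zero: no coboundaries -/

namespace CategoryTheory.ProjectiveResolution

open CochainComplex HomComplex

theorem eq_zero_of_extMk_zero_eq_zero {C : Type*} [Category* C] [Abelian C] [HasExt C]
    {X Y : C} (R : ProjectiveResolution X) (f : R.complex.X 0 ⟶ Y)
    (hf : R.complex.d 1 0 ≫ f = 0) (h : R.extMk f 1 rfl hf = 0) : f = 0 := by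
  rw [← R.extEquivCohomologyClass.apply_eq_iff_eq, extEquivCohomologyClass_extMk,
    extEquivCohomologyClass_zero, CohomologyClass.mk_eq_zero_iff,
    Cocycle.toSingleMk_mem_coboundaries_iff _ _ _ _ _ 1 (by simp)] at h
  obtain ⟨g, hg⟩ := h
  -- A coboundary in degree 0 would factor through cohomological degree 1 of the resolution, which
  -- is zero.
  rw [(R.cochainComplex.isZero_of_isStrictlyLE 0 1).eq_of_src g 0, Limits.comp_zero] at hg
  rw [← cancel_epi (R.cochainComplexXIso (-((0 : ℕ) : ℤ)) 0 rfl).hom, ← hg, Limits.comp_zero]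

end CategoryTheory.ProjectiveResolution

/-! ### Cocycles and coboundaries in coordinates -/

noncomputable section

namespace QCI

variable (k : Type u) [Field k]

theorem γ_smul (s : ℤ) (z m : Alg k) :
    γ k s z • (show bimod k (Alg k) from m) = (m * z + s • (z * m) : Alg k) := by
  obtain ⟨e, he⟩ : ∃ e : bimod k (Alg k), e = m := ⟨m, rfl⟩
  have h₁ : Env.tmul k 1 z • e = (m * z : Alg k) := by
    subst he
    exact (env_tmul_smul k (Alg k) 1 z _).trans (congrArg (· * z) (one_mul (M := Alg k) _))
  have h₂ : Env.tmul k z 1 • e = (z * m : Alg k) := by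
    subst he
    exact (env_tmul_smul k (Alg k) z 1 _).trans (mul_one (M := Alg k) _)
  have h₃ : γ k s z • e = Env.tmul k 1 z • e + s • Env.tmul k z 1 • e := by
    rw [γ, add_smul, smul_assoc]
  subst he
  refine h₃.trans ?_
  rw [h₁, h₂]
  rfl

/-- The value of a cochain on `f^n_i`. -/
def value {n : ℕ} (φ : P k n →ₗ[Ae k] bimod k (Alg k)) (i : ℤ) : Alg k := φ (f k n i)

theorem value_comp_d {n : ℕ} (φ : P k n →ₗ[Ae k] bimod k (Alg k)) (i : ℕ) :
    value k (φ ∘ₗ d k n) i = (-1 : ℤ) ^ i •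
      (value k φ i * y k + dSign n • (y k * value k φ i) +
      dSign n • (value k φ (i - 1) * x k + dSign n • (x k * value k φ (i - 1)))) := by
  rw [← γ_smul, ← γ_smul]
  change φ (d k n (f k (n + 1) i)) = _
  rw [d_f, dGen_eq, map_zsmul, map_add, map_smul, map_zsmul, map_smul]
  rfl

theorem value_of_lt {n : ℕ} (φ : P k n →ₗ[Ae k] bimod k (Alg k)) {i : ℕ} (hi : n < i) :
    value k φ i = 0 := by
  rw [value, f_of_lt k n i hi, map_zero]
  rfl

theorem value_neg_one {n : ℕ} (φ : P k n →ₗ[Ae k] bimod k (Alg k)) :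
    value k φ (-1) = 0 := by
  rw [value, f_neg, map_zero]
  rfl

theorem ext_value {n : ℕ} {φ ψ : P k n →ₗ[Ae k] bimod k (Alg k)}
    (h : ∀ i ≤ n, value k φ (i : ℕ) = value k ψ (i : ℕ)) : φ = ψ := by
  refine hom_ext k fun i => ?_
  rcases Nat.lt_or_ge n i with hi | hi
  · rw [f_of_lt k n i hi, map_zero, map_zero]
  · exact h i hi

theorem value_cochain {n : ℕ} (p : Fin (n + 1) → Alg k) {i : ℕ} (hi : i < n + 1) :
    value k (cochain k p) i = p ⟨i, hi⟩ := by
  rw [value, f_of_le k n i hi, cochain_f]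

theorem coord_mul_x (m : Fin 4) (a : Alg k) : coord k m (a * x k) =
    coord k 0 a * (if m = 1 then 1 else 0) - coord k 2 a * (if m = 3 then 1 else 0) := by
  conv_lhs => rw [eq_sum_coord k a]
  simp [add_mul, mul_assoc, x_mul_x, y_mul_x, x_mul_x_mul, coord_x, coord_xy, sub_eq_add_neg]

theorem coord_x_mul (m : Fin 4) (a : Alg k) : coord k m (x k * a) =
    coord k 0 a * (if m = 1 then 1 else 0) + coord k 2 a * (if m = 3 then 1 else 0) := by
  conv_lhs => rw [eq_sum_coord k a]
  simp [mul_add, x_mul_x, x_mul_x_mul, coord_x, coord_xy]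

theorem coord_mul_y (m : Fin 4) (a : Alg k) : coord k m (a * y k) =
    coord k 0 a * (if m = 2 then 1 else 0) + coord k 1 a * (if m = 3 then 1 else 0) := by
  conv_lhs => rw [eq_sum_coord k a]
  simp [add_mul, mul_assoc, y_mul_y, coord_y, coord_xy]

theorem coord_y_mul (m : Fin 4) (a : Alg k) : coord k m (y k * a) =
    coord k 0 a * (if m = 2 then 1 else 0) - coord k 1 a * (if m = 3 then 1 else 0) := by
  conv_lhs => rw [eq_sum_coord k a]
  simp [mul_add, y_mul_y, y_mul_x, y_mul_x_mul, coord_y, coord_xy, sub_eq_add_neg]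

theorem coord_ext {a b : Alg k} (h : ∀ m, coord k m a = coord k m b) : a = b := by
  rw [eq_sum_coord k a, eq_sum_coord k b, h, h, h, h]

theorem dSign_of_even {n : ℕ} (hn : Even n) : dSign n = -1 := hn.add_one.neg_one_pow

theorem dSign_of_odd {n : ℕ} (hn : Odd n) : dSign n = 1 := hn.add_one.neg_one_pow

/-- For even n the differential is built from commutators, and [a, y] = 2a₁ xy, [a, x] = -2a₂ xy,
where a₁, a₂ are the coordinates of a at x, y. The xy-coordinate of the cocycle equation is twice
the claim. -/
theorem coord_value_of_cocycle (h2 : (2 : k) ≠ 0) {n : ℕ} (hn : Even n)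
    {φ : P k n →ₗ[Ae k] bimod k (Alg k)} (hφ : φ ∘ₗ d k n = 0) (i : ℕ) :
    coord k 1 (value k φ i) = -coord k 2 (value k φ (i - 1)) := by
  have h := congrArg (coord k 3) (value_comp_d k φ i)
  have h₀ : value k (φ ∘ₗ d k n) i = 0 := by rw [hφ]; rfl
  rw [h₀, map_zero, dSign_of_even hn] at h
  refine mul_left_cancel₀ h2 ?_
  rcases neg_one_pow_eq_or ℤ i with e | e <;>
  simp only [e, map_add, neg_smul, one_smul, map_neg, coord_mul_x, coord_x_mul, coord_mul_y,
    coord_y_mul, Fin.reduceEq, if_true, if_false] at h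
  · linear_combination -h
  · linear_combination h

/-- For odd n the differential is built from anticommutators, and ay + ya = 2a₀ y, ax + xa = 2a₀ x,
where a₀ is the coordinate of a at 1. -/
theorem coord_value_of_coboundary {n : ℕ} (hn : Odd n)
    (φ : P k n →ₗ[Ae k] bimod k (Alg k)) (i : ℕ) :
    coord k 0 (value k (φ ∘ₗ d k n) i) = 0 ∧ coord k 3 (value k (φ ∘ₗ d k n) i) = 0 := by
  rw [value_comp_d, dSign_of_odd hn]
  constructor <;>
  · rw [map_zsmul]
    simp [coord_mul_x, coord_x_mul, coord_mul_y, coord_y_mul]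

/-! ### Classes of cochains in Ext -/

theorem cls_eq_zero_iff (h : QuasiIso (augmentation k)) {n : ℕ}
    (φ : P k (n + 1) →ₗ[Ae k] bimod k (Alg k)) (hφ : φ ∘ₗ d k (n + 1) = 0) :
    cls k h φ hφ = 0 ↔ ∃ g : P k n →ₗ[Ae k] bimod k (Alg k), g ∘ₗ d k n = φ := by
  refine ((resolution k h).extMk_eq_zero_iff _ (n + 2) rfl _ n rfl).trans ⟨?_, ?_⟩
  · rintro ⟨g, hg⟩
    exact ⟨g.hom, congrArg ModuleCat.Hom.hom
      ((congrArg (· ≫ g) (complex_d k n)).symm.trans hg)⟩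
  · rintro ⟨g, hg⟩
    exact ⟨ModuleCat.ofHom (Y := bimod k (Alg k)) g,
      (congrArg (· ≫ ModuleCat.ofHom (Y := bimod k (Alg k)) g) (complex_d k n)).trans
        (ModuleCat.hom_ext hg)⟩

theorem eq_zero_of_cls_eq_zero (h : QuasiIso (augmentation k))
    (φ : P k 0 →ₗ[Ae k] bimod k (Alg k)) (hφ : φ ∘ₗ d k 0 = 0) (hc : cls k h φ hφ = 0) :
    φ = 0 :=
  congrArg ModuleCat.Hom.hom ((resolution k h).eq_zero_of_extMk_zero_eq_zero _ _ hc)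

theorem cls_surjective (h : QuasiIso (augmentation k)) {n : ℕ} (c : HH k (Alg k) n) :
    ∃ φ hφ, cls k h (n := n) φ hφ = c := by
  obtain ⟨φ, hφ, rfl⟩ := (resolution k h).extMk_surjective c (n + 1) rfl
  exact ⟨φ.hom, congrArg ModuleCat.Hom.hom ((congrArg (· ≫ φ) (complex_d k n)).symm.trans hφ),
    rfl⟩

theorem cls_add (h : QuasiIso (augmentation k)) {n : ℕ} (φ ψ : P k n →ₗ[Ae k] bimod k (Alg k))
    (hφ : φ ∘ₗ d k n = 0) (hψ : ψ ∘ₗ d k n = 0) :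
    cls k h (φ + ψ) (by rw [LinearMap.add_comp, hφ, hψ, add_zero]) =
      cls k h φ hφ + cls k h ψ hψ :=
  ((resolution k h).add_extMk _ _ (n + 1) rfl _ _).symm

theorem cls_sub (h : QuasiIso (augmentation k)) {n : ℕ} (φ ψ : P k n →ₗ[Ae k] bimod k (Alg k))
    (hφ : φ ∘ₗ d k n = 0) (hψ : ψ ∘ₗ d k n = 0) :
    cls k h (φ - ψ) (by rw [LinearMap.sub_comp, hφ, hψ, sub_zero]) =
      cls k h φ hφ - cls k h ψ hψ :=
  ((resolution k h).sub_extMk _ _ (n + 1) rfl _ _).symm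

/-! ### The basis in even degree -/

/-- The cochain with value `aᵢ + bᵢ xy` on `f^n_i`. -/
def centralCochain {n : ℕ} (c : (Fin (n + 1) → k) × (Fin (n + 1) → k)) :
    P k n →ₗ[Ae k] bimod k (Alg k) :=
  cochain k fun i => c.1 i • (1 : Alg k) + c.2 i • (x k * y k)

theorem d_comp_centralCochain {n : ℕ} (hn : Even n) (c : (Fin (n + 1) → k) × (Fin (n + 1) → k)) :
    centralCochain k c ∘ₗ d k n = 0 := by
  refine d_comp_cochain k hn _ (fun i => ?_) (fun i => ?_) <;>
  simp [add_mul, mul_add, xy_mul_comm]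

theorem value_centralCochain {n : ℕ} (c : (Fin (n + 1) → k) × (Fin (n + 1) → k)) {i : ℕ}
    (hi : i < n + 1) : value k (centralCochain k c) i =
      c.1 ⟨i, hi⟩ • (1 : Alg k) + c.2 ⟨i, hi⟩ • (x k * y k) :=
  value_cochain k _ hi

theorem value_add {n : ℕ} (φ ψ : P k n →ₗ[Ae k] bimod k (Alg k)) (i : ℤ) :
    value k (φ + ψ) i = value k φ i + value k ψ i := rfl

theorem value_sub {n : ℕ} (φ ψ : P k n →ₗ[Ae k] bimod k (Alg k)) (i : ℤ) :
    value k (φ - ψ) i = value k φ i - value k ψ i := rfl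

theorem smul_id_apply (r : k) (m : bimod k (Alg k)) :
    (r • 𝟙 (bimod k (Alg k)) : bimod k (Alg k) ⟶ bimod k (Alg k)) m =
      (r • (show Alg k from m) : Alg k) := by
  have h : algebraMap k (Ae k) r = Env.tmul k (r • 1) 1 := by
    rw [← Algebra.algebraMap_eq_smul_one]
    rfl
  change algebraMap k (Ae k) r • m = _
  rw [h]
  refine (env_tmul_smul k (Alg k) (r • 1) 1 m).trans ?_
  change r • (1 : Alg k) * _ * 1 = _
  rw [smul_mul_assoc, one_mul, mul_one]

/-- The classes of the cochains with values in the span of `1` and `xy`. -/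
def centralCls (h : QuasiIso (augmentation k)) {n : ℕ} (hn : Even n) :
    (Fin (n + 1) → k) × (Fin (n + 1) → k) →ₗ[k] HH k (Alg k) n where
  toFun c := cls k h (centralCochain k c) (d_comp_centralCochain k hn c)
  map_add' c c' := by
    rw [← cls_add]
    refine cls_congr k h _ _ (ext_value k fun i hi => ?_)
    rw [value_add, value_centralCochain k _ (by omega), value_centralCochain k _ (by omega),
      value_centralCochain k _ (by omega)]
    simp only [Prod.fst_add, Prod.snd_add, Pi.add_apply]
    module
  map_smul' r c := by
    rw [RingHom.id_apply, Ext.smul_eq_comp_mk₀]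
    refine (cls_comp_mk₀ k h _ _ _ _ _ (ext_value k fun i hi => ?_)).symm
    refine (smul_id_apply k r _).trans ?_
    change r • value k (centralCochain k c) i = _
    rw [value_centralCochain k _ (by omega), value_centralCochain k _ (by omega)]
    simp only [Prod.smul_fst, Prod.smul_snd, Pi.smul_apply, smul_eq_mul]
    module

theorem centralCls_injective (h : QuasiIso (augmentation k)) {n : ℕ} (hn : Even n) :
    Function.Injective (centralCls k h hn) := by
  rw [injective_iff_map_eq_zero]
  intro c hc
  have key (i : Fin (n + 1)) : coord k 0 (value k (centralCochain k c) (i : ℕ)) = 0 ∧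
      coord k 3 (value k (centralCochain k c) (i : ℕ)) = 0 := by
    cases n with
    | zero =>
      rw [eq_zero_of_cls_eq_zero k h _ (d_comp_centralCochain k hn c) hc]
      exact ⟨map_zero _, map_zero _⟩
    | succ m =>
      obtain ⟨g, hg⟩ := (cls_eq_zero_iff k h _ (d_comp_centralCochain k hn c)).mp hc
      rw [← hg]
      exact coord_value_of_coboundary k (by simpa [Nat.even_add_one] using hn) g i
  simp only [value_centralCochain k c (Fin.is_lt _), map_add, map_smul, coord_one, coord_xy] at key
  refine Prod.ext (funext fun i => ?_) (funext fun i => ?_)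
  · simpa using (key i).1
  · simpa using (key i).2

/-- The complement of the central part of a cocycle is a coboundary. -/
theorem exists_comp_d_eq (h2 : (2 : k) ≠ 0) {n : ℕ} (hn : Odd n)
    {ψ : P k (n + 1) →ₗ[Ae k] bimod k (Alg k)} (hψ : ψ ∘ₗ d k (n + 1) = 0)
    (h₀ : ∀ i : ℕ, coord k 0 (value k ψ i) = 0) (h₃ : ∀ i : ℕ, coord k 3 (value k ψ i) = 0) :
    ∃ g : P k n →ₗ[Ae k] bimod k (Alg k), g ∘ₗ d k n = ψ := by
  have h₁ := coord_value_of_cocycle k h2 hn.add_one hψ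
  -- With c_i the y-coordinate of ψ at f_i, the value of g∘d there is (-1)^i (2g_i y + 2g_{i-1} x).
  -- Taking g_i = (-1)^i c_i / 2 gives c_i y - c_{i-1} x, which is the value of ψ.
  let g : P k n →ₗ[Ae k] bimod k (Alg k) :=
    cochain k fun i => ((-1) ^ (i : ℕ) * 2⁻¹ * coord k 2 (value k ψ (i : ℕ))) • (1 : Alg k)
  have hg (i : ℕ) : value k g i =
      ((-1) ^ i * 2⁻¹ * coord k 2 (value k ψ i)) • (1 : Alg k) := by
    rcases Nat.lt_or_ge i (n + 1) with hi | hi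
    · exact value_cochain k _ hi
    · rw [value_of_lt k g hi]
      -- The formula for g must also hold past its last index n, notably at n + 1. There the cocycle
      -- equation one index further, where ψ is zero by convention, forces c_i = 0.
      have := h₁ (i + 1)
      rw [value_of_lt k ψ (by omega), map_zero, Nat.cast_add_one, add_sub_cancel_right,
        zero_eq_neg] at this
      rw [this, mul_zero, zero_smul]
  have hψi (i : ℕ) : value k ψ i =
      (-coord k 2 (value k ψ (i - 1))) • x k + coord k 2 (value k ψ i) • y k := by
    conv_lhs => rw [eq_sum_coord k (value k ψ i), h₀, h₃, h₁]
    simp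
  refine ⟨g, ext_value k fun i _ => ?_⟩
  rw [value_comp_d, dSign_of_odd hn, hψi, hg]
  have hc : ((-1 : ℤ) ^ i) = 1 ∧ ((-1 : k) ^ i) = 1 ∨
      ((-1 : ℤ) ^ i) = -1 ∧ ((-1 : k) ^ i) = -1 := by
    rcases Nat.even_or_odd i with e | e
    · exact Or.inl ⟨e.neg_one_pow, e.neg_one_pow⟩
    · exact Or.inr ⟨e.neg_one_pow, e.neg_one_pow⟩
  obtain ⟨a, ha⟩ : ∃ a, coord k 2 (value k ψ i) = 2 * a := ⟨_, (mul_inv_cancel_left₀ h2 _).symm⟩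
  rw [ha, mul_assoc, inv_mul_cancel_left₀ h2]
  rcases i with _ | j
  · rw [Nat.cast_zero, zero_sub, value_neg_one, value_neg_one]
    simp only [smul_mul_assoc, mul_smul_comm, one_mul, mul_one, zero_mul, mul_zero, map_zero,
      pow_zero]
    module
  · have e : (((j + 1 : ℕ) : ℤ) - 1) = (j : ℕ) := by omega
    obtain ⟨b, hb⟩ : ∃ b, coord k 2 (value k ψ j) = 2 * b :=
      ⟨_, (mul_inv_cancel_left₀ h2 _).symm⟩
    rw [e, hg, hb, mul_assoc, inv_mul_cancel_left₀ h2]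
    rcases hc with ⟨e₁, e₂⟩ | ⟨e₁, e₂⟩
    · have e₃ : (-1 : k) ^ j = -1 := by rw [pow_succ] at e₂; linear_combination -e₂
      rw [e₁, e₂, e₃]
      simp only [smul_mul_assoc, mul_smul_comm, one_mul, mul_one]
      module
    · have e₃ : (-1 : k) ^ j = 1 := by rw [pow_succ] at e₂; linear_combination -e₂
      rw [e₁, e₂, e₃]
      simp only [smul_mul_assoc, mul_smul_comm, one_mul, mul_one]
      module

theorem centralCls_surjective (h2 : (2 : k) ≠ 0) (h : QuasiIso (augmentation k)) {n : ℕ}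
    (hn : Even n) : Function.Surjective (centralCls k h hn) := by
  intro c
  obtain ⟨φ, hφ, rfl⟩ := cls_surjective k h c
  -- The preimage is read off from the coordinates at 1 and xy; what is left of φ has values in the
  -- span of x and y.
  let q : (Fin (n + 1) → k) × (Fin (n + 1) → k) :=
    (fun i => coord k 0 (value k φ (i : ℕ)), fun i => coord k 3 (value k φ (i : ℕ)))
  have hq := d_comp_centralCochain k hn q
  refine ⟨q, sub_eq_zero.mp ((cls_sub k h _ _ hq hφ).symm.trans ?_)⟩
  have hψ : (centralCochain k q - φ) ∘ₗ d k n = 0 := by rw [LinearMap.sub_comp, hφ, hq, sub_zero]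
  have hc (i : ℕ) : coord k 0 (value k (centralCochain k q - φ) i) = 0 ∧
      coord k 3 (value k (centralCochain k q - φ) i) = 0 := by
    rcases Nat.lt_or_ge n i with hi | hi
    · rw [value_of_lt k _ hi, map_zero, map_zero]
      exact ⟨rfl, rfl⟩
    · rw [value_sub, value_centralCochain k q (by omega)]
      simp [q, coord_one, coord_xy]
  cases n with
  | zero =>
    have h₁ := coord_value_of_cocycle k h2 hn hψ
    have h₀ : centralCochain k q - φ = 0 := ext_value k fun i hi => by
      obtain rfl : i = 0 := by omega
      -- With no coboundaries in degree 0, the rest must itself vanish: the cocycle equations at the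
      -- two ends, i = 0 and i = 1, kill its x- and y-coordinates.
      have e₁ := h₁ 0
      have e₂ := h₁ 1
      rw [Nat.cast_zero, zero_sub, value_neg_one, map_zero, neg_zero] at e₁
      rw [value_of_lt k _ one_pos, Nat.cast_one, sub_self, map_zero, zero_eq_neg] at e₂
      refine coord_ext k fun m => ?_
      refine Eq.trans ?_ (map_zero (coord k m)).symm
      fin_cases m
      exacts [(hc 0).1, e₁, e₂, (hc 0).2]
    exact (cls_congr k h _ (LinearMap.zero_comp _) h₀).trans ((resolution k h).extMk_zero _ _)
  | succ m =>
    exact (cls_eq_zero_iff k h _ _).mpr (exists_comp_d_eq k h2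
      (by simpa [Nat.even_add_one] using hn) hψ (fun i => (hc i).1) fun i => (hc i).2)

/-- The basis of `HHⁿ(A)`, `n` even, by the classes of the `ξ_r` and the `η_r`. -/
def basisHH (h2 : (2 : k) ≠ 0) (h : QuasiIso (augmentation k)) {n : ℕ} (hn : Even n) :
    Module.Basis (Fin (n + 1) ⊕ Fin (n + 1)) k (HH k (Alg k) n) :=
  ((Pi.basisFun k (Fin (n + 1))).prod (Pi.basisFun k (Fin (n + 1)))).map
    (LinearEquiv.ofBijective (centralCls k h hn)
      ⟨centralCls_injective k h hn, centralCls_surjective k h2 h hn⟩)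

theorem basisHH_inl (h2 : (2 : k) ≠ 0) (h : QuasiIso (augmentation k)) {n : ℕ} (hn : Even n)
    (r : Fin (n + 1)) :
    basisHH k h2 h hn (Sum.inl r) = cls k h (ξ k r) (d_comp_ξ k hn r) := by
  rw [basisHH, Module.Basis.map_apply]
  refine cls_congr k h (d_comp_centralCochain k hn _) _ (ext_value k fun i hi => ?_)
  rw [value_centralCochain k _ (by omega), ξ, value_cochain k _ (by omega)]
  simp [Pi.single_apply]

theorem basisHH_inr (h2 : (2 : k) ≠ 0) (h : QuasiIso (augmentation k)) {n : ℕ} (hn : Even n)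
    (r : Fin (n + 1)) :
    basisHH k h2 h hn (Sum.inr r) = cls k h (η k r) (d_comp_η k hn r) := by
  rw [basisHH, Module.Basis.map_apply]
  refine cls_congr k h (d_comp_centralCochain k hn _) _ (ext_value k fun i hi => ?_)
  rw [value_centralCochain k _ (by omega), η, value_cochain k _ (by omega)]
  simp [Pi.single_apply]

end QCI

end

theorem lemma4p1 (k : Type u) [Field k] (hk : ringChar k ≠ 2) :
    ∃ h : QuasiIso (QCI.augmentation k), ∀ t : ℕ,
      (∃ b : Module.Basis (Fin (2 * t + 1) ⊕ Fin (2 * t + 1)) k (HH k (QCI.Alg k) (2 * t)),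
        (∀ r, b (Sum.inl r) = QCI.cls k h (QCI.ξ k r) (QCI.d_comp_ξ k (even_two_mul t) r)) ∧
        (∀ r, b (Sum.inr r) = QCI.cls k h (QCI.η k r) (QCI.d_comp_η k (even_two_mul t) r))) ∧
      ∀ r : Fin (2 * t + 1), IsNilpotent (DirectSum.of (HH k (QCI.Alg k)) (2 * t)
        (QCI.cls k h (QCI.η k r) (QCI.d_comp_η k (even_two_mul t) r)) : HHRing k (QCI.Alg k)) :=
  ⟨QCI.quasiIso_augmentation k, fun t =>
    ⟨⟨QCI.basisHH k (Ring.two_ne_zero hk) _ (even_two_mul t), QCI.basisHH_inl k _ _ _,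
      QCI.basisHH_inr k _ _ _⟩, QCI.isNilpotent_cls_η k _ (even_two_mul t)⟩⟩
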